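/- Let $d\ge 2$ be an integer. A $d$-ary tree is a (nonempty, finite) rooted tree in which every internal (non-leaf) vertex has at least two and at most $d$ children; $\|T\|$ denotes the number of leaves of $T$. A set $S$ of leaves of $T$ induces a $d$-ary tree: take the smallest subtree of $T$ containing $S$ and suppress all vertices with only one child. For $d$-ary trees $D$ and $T$ let $c(D,T)$ be the number of sets of $\|D\|$ leaves of $T$ that induce a tree isomorphic (as a rooted tree) to $D$, and let $\gamma(D,T)=c(D,T)/\binom{\|T\|}{\|D\|}$. The $d$-ary inducibility of $D$ is $$I_d(D)=\limsup_{n\to\infty}\ \max_{\substack{\|T\|=n\\ T\ d\text{-ary tree}}}\gamma(D,T).$$ The branches of a tree are the rooted trees that remain when its root is removed. Theorem. Let $D$ and $D'$ be $d$-ary trees such that $D$ has exactly $d$ branches, all of which are isomorphic to $D'$. Then $$\frac{\|D\|!}{d^{\|D\|}}\left(\frac{I_d(D')}{\|D'\|!}\right)^d\ \le\ I_d(D)\ \le\ \frac{\|D\|!}{d^{\|D\|}-d}\left(\frac{I_d(D')}{\|D'\|!}\right)^d .$$ -/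

import Mathlib

open Filter
open scoped Nat

/-- Finite rooted trees in which every internal vertex has `d` slots for branches; a slot may hold
the empty tree, so an internal vertex has at most `d` children. The order of the slots is only a
matter of representation: it is forgotten by `DTree.Iso`. -/
inductive DTree (d : ℕ) : Type
  | empty : DTree d
  | leaf : DTree d
  | node (f : Fin d → DTree d) : DTree d

namespace DTree

variable {d : ℕ}

/-- Every internal vertex has at least two children. -/
def IsProper : DTree d → Prop
  | empty => True
  | leaf => True
  | node f => (∃ i j, i ≠ j ∧ f i ≠ empty ∧ f j ≠ empty) ∧ ∀ i, IsProper (f i)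

/-- A `d`-ary tree: a (nonempty) rooted tree all of whose internal vertices have at least two and
at most `d` children. -/
def IsDary (T : DTree d) : Prop := T ≠ empty ∧ T.IsProper

/-- Isomorphism of rooted trees: the branches agree up to a permutation, recursively. -/
def Iso : DTree d → DTree d → Prop
  | empty, empty => True
  | leaf, leaf => True
  | node f, node g => ∃ σ : Equiv.Perm (Fin d), ∀ i, Iso (f i) (g (σ i))
  | _, _ => False

/-- The `d` branches of a tree, some of them possibly empty: the trees that remain when the root is
removed. -/
def branch : DTree d → Fin d → DTree d
  | node f => f
  | _ => fun _ => empty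

/-- The type of leaves of a tree. -/
def Leaf : DTree d → Type
  | empty => Empty
  | leaf => Unit
  | node f => Σ i, Leaf (f i)

instance instFiniteLeaf : (T : DTree d) → Finite T.Leaf
  | empty => inferInstanceAs (Finite Empty)
  | leaf => inferInstanceAs (Finite Unit)
  | node f =>
    have : ∀ i, Finite (f i).Leaf := fun i => instFiniteLeaf (f i)
    inferInstanceAs (Finite (Σ i, (f i).Leaf))

/-- The size `‖T‖` of a tree: its number of leaves. -/
noncomputable def size (T : DTree d) : ℕ := Nat.card T.Leaf

open Classical in
/-- Join the trees `g i` at a common root, where a root that has only one child is suppressed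
(the result is then that child), and a root without children is deleted. -/
noncomputable def join (g : Fin d → DTree d) : DTree d :=
  if ∃ i j, i ≠ j ∧ g i ≠ empty ∧ g j ≠ empty then node g
  else if h : ∃ i, g i ≠ empty then g h.choose
  else empty

open Classical in
/-- The subtree of `T` induced by a set `S` of leaves: all vertices without a descendant in `S` are
deleted, and all vertices that are left with a single child are suppressed. -/
noncomputable def induced : (T : DTree d) → Set T.Leaf → DTree d
  | empty, _ => empty
  | leaf, S => if S.Nonempty then leaf else empty
  | node f, S => join fun i => induced (f i) {x | (⟨i, x⟩ : Σ i, Leaf (f i)) ∈ S}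

/-- `c(D, T)`: the number of sets of `‖D‖` leaves of `T` that induce a tree isomorphic to `D`. -/
noncomputable def copies (D T : DTree d) : ℕ :=
  {S : Set T.Leaf | S.ncard = D.size ∧ (T.induced S).Iso D}.ncard

/-- The density `γ(D, T)`. -/
noncomputable def density (D T : DTree d) : ℝ :=
  (copies D T : ℝ) / (T.size.choose D.size : ℝ)

/-- The maximum of `γ(D, T)` over all `d`-ary trees `T` with `n` leaves. -/
noncomputable def maxDensity (D : DTree d) (n : ℕ) : ℝ :=
  sSup {x : ℝ | ∃ T : DTree d, T.IsDary ∧ T.size = n ∧ density D T = x}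

/-- The `d`-ary inducibility `I_d(D)`. -/
noncomputable def inducibility (D : DTree d) : ℝ :=
  limsup (fun n : ℕ => maxDensity D n) atTop

end DTree

/-! ### Isomorphism, sizes and induced subtrees -/

namespace DTree

variable {d : ℕ}

/-! Write k = ‖D'‖. A leaf set inducing D either lies in one branch of T or meets each of the d
branches in a set inducing D', so c(D, T) is at most ∑ c(D, T_i) + ∏ c(D', T_i), and at least the
product (`copies_node_le`, `prod_copies_le_copies_node`).

Lower bound: join d copies of a nearly optimal tree for D' with m leaves. The product gives c(D',
T)^d copies of D, and binom(m, k)^d / binom(dm, dk) converges to the required constant.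

Upper bound: if c(D', T) ≤ b‖T‖^k for large T, induction on T gives c(D, T) ≤ A‖T‖^(dk) + error,
with A = b^d / (d^(dk) - d). The induction closes by `sum_pow_add_prod_pow_le_sum_pow`, an AM-GM
inequality for the branch sizes. The error has degree (d-1)k + 1, which is below dk unless k = 1; in
that case it is made to vanish identically. -/

theorem Iso.refl : (T : DTree d) → T.Iso T
  | empty => trivial
  | leaf => trivial
  | node f => ⟨1, fun i => Iso.refl (f i)⟩

theorem Iso.symm : {T U : DTree d} → T.Iso U → U.Iso T
  | empty, empty, _ => trivial
  | leaf, leaf, _ => trivial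
  | node f, node g, ⟨σ, h⟩ => ⟨σ⁻¹, fun i => by
      have := Iso.symm (h (σ⁻¹ i))
      simpa using this⟩

theorem Iso.trans : {T U V : DTree d} → T.Iso U → U.Iso V → T.Iso V
  | empty, empty, empty, _, _ => trivial
  | leaf, leaf, leaf, _, _ => trivial
  | node _, node _, node _, ⟨σ, h⟩, ⟨τ, h'⟩ =>
      ⟨τ * σ, fun i => Iso.trans (h i) (h' (σ i))⟩

theorem size_empty : (empty : DTree d).size = 0 :=
  Nat.card_eq_zero.2 (Or.inl (inferInstanceAs (IsEmpty Empty)))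

theorem size_leaf : (leaf : DTree d).size = 1 :=
  (Nat.card_unique : Nat.card Unit = 1)

theorem size_node (f : Fin d → DTree d) : (node f).size = ∑ i, (f i).size :=
  (Nat.card_sigma : Nat.card (Σ i, (f i).Leaf) = _)

theorem Iso.size_eq : {T U : DTree d} → T.Iso U → T.size = U.size
  | empty, empty, _ => rfl
  | leaf, leaf, _ => rfl
  | node f, node g, ⟨σ, h⟩ => by
      rw [size_node, size_node, ← Equiv.sum_comp σ fun i => (g i).size]
      exact Finset.sum_congr rfl fun i _ => Iso.size_eq (h i)

theorem Iso.ne_empty {T U : DTree d} (h : T.Iso U) (hU : U ≠ empty) : T ≠ empty := by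
  rintro rfl
  cases U with
  | empty => exact hU rfl
  | leaf => exact h
  | node g => exact h

theorem size_join (g : Fin d → DTree d) : (join g).size = ∑ i, (g i).size := by
  classical
  unfold join
  split_ifs with h h'
  · exact size_node g
  · have key : ∀ i, i ≠ h'.choose → g i = empty := fun i hi => by
      by_contra hne
      exact h ⟨i, h'.choose, hi, hne, h'.choose_spec⟩
    rw [Finset.sum_eq_single h'.choose (fun i _ hi => by rw [key i hi, size_empty])
      (fun hi => absurd (Finset.mem_univ _) hi)]
  · push Not at h'
    simp [h', size_empty]

theorem join_ne_empty {g : Fin d → DTree d} {i : Fin d} (hi : g i ≠ empty) :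
    join g ≠ empty := by
  classical
  unfold join
  split_ifs with h h'
  · simp
  · exact h'.choose_spec
  · exact absurd ⟨i, hi⟩ h'

theorem induced_node (f : Fin d → DTree d) (S : Set (node f).Leaf) :
    (node f).induced S =
      join fun i => (f i).induced (Sigma.mk (β := fun i => (f i).Leaf) i ⁻¹' S) := rfl

theorem induced_ne_empty : (T : DTree d) → {S : Set T.Leaf} → S.Nonempty → T.induced S ≠ empty
  | empty, _, ⟨x, _⟩ => Empty.elim x
  | leaf, S, h => by
      rw [induced, if_pos h]
      simp
  | node f, S, ⟨⟨i, x⟩, h⟩ => by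
      rw [induced_node]
      exact join_ne_empty (i := i) (induced_ne_empty (f i) ⟨x, h⟩)

theorem ncard_eq_sum_ncard_preimage {ι : Type*} [Fintype ι] {A : ι → Type*} [∀ i, Finite (A i)]
    (S : Set (Σ i, A i)) : S.ncard = ∑ i, (Sigma.mk i ⁻¹' S).ncard := by
  let e : S ≃ Σ i, (Sigma.mk i ⁻¹' S : Set (A i)) :=
    { toFun := fun x => ⟨x.1.1, x.1.2, x.2⟩
      invFun := fun x => ⟨⟨x.1, x.2.1⟩, x.2.2⟩
      left_inv := fun _ => rfl
      right_inv := fun _ => rfl }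
  rw [← Nat.card_coe_set_eq, Nat.card_congr e, Nat.card_sigma]
  simp only [Nat.card_coe_set_eq]

theorem ncard_setOf_preimage_mem {ι : Type*} [Fintype ι] {A : ι → Type*}
    (C : ∀ i, Set (Set (A i))) :
    {S : Set (Σ i, A i) | ∀ i, Sigma.mk i ⁻¹' S ∈ C i}.ncard = ∏ i, (C i).ncard := by
  let e : {S : Set (Σ i, A i) | ∀ i, Sigma.mk i ⁻¹' S ∈ C i} ≃ ∀ i, C i :=
    { toFun := fun S i => ⟨Sigma.mk i ⁻¹' S.1, S.2 i⟩
      invFun := fun s => ⟨{x | x.2 ∈ (s x.1).1}, fun i => (s i).2⟩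
      left_inv := fun _ => rfl
      right_inv := fun _ => rfl }
  rw [← Nat.card_coe_set_eq, Nat.card_congr e, Nat.card_pi]
  simp only [Nat.card_coe_set_eq]

theorem size_induced : (T : DTree d) → (S : Set T.Leaf) → (T.induced S).size = S.ncard
  | empty, S => by
      have : IsEmpty (empty : DTree d).Leaf := inferInstanceAs (IsEmpty Empty)
      rw [Set.eq_empty_of_isEmpty S, Set.ncard_empty]
      exact size_empty
  | leaf, S => by
      have : Subsingleton (leaf : DTree d).Leaf := inferInstanceAs (Subsingleton Unit)
      rw [induced]
      split_ifs with h
      · obtain ⟨x, hx⟩ := h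
        rw [size_leaf, (Set.subsingleton_of_subsingleton (s := S)).eq_singleton_of_mem hx,
          Set.ncard_singleton]
      · rw [size_empty, Set.not_nonempty_iff_eq_empty.1 h, Set.ncard_empty]
  | node f, S => by
      rw [induced_node, size_join]
      refine Eq.trans (Finset.sum_congr rfl fun i _ => size_induced (f i) _) ?_
      exact (ncard_eq_sum_ncard_preimage (A := fun i => (f i).Leaf) S).symm

/-! ### Counting copies through the branches -/

theorem copies_le_choose (D T : DTree d) : copies D T ≤ T.size.choose D.size := by
  rw [size, ← Set.ncard_univ, ← Set.ncard_powerset_ncard Set.finite_univ]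
  exact Set.ncard_le_ncard (fun S hS => ⟨Set.subset_univ _, hS.1⟩) (Set.toFinite _)

theorem copies_eq (D T : DTree d) : copies D T = {S : Set T.Leaf | (T.induced S).Iso D}.ncard := by
  unfold copies
  congr 1
  ext S
  exact ⟨fun h => h.2, fun h => ⟨(size_induced T S).symm.trans h.size_eq, h⟩⟩

/-- With all branches isomorphic the permutation plays no role, so the count is a single product
rather than a sum over assignments. -/
theorem node_iso_node_iff {D' : DTree d} {f g : Fin d → DTree d} (hg : ∀ i, (g i).Iso D') :
    (node f).Iso (node g) ↔ ∀ i, (f i).Iso D' :=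
  ⟨fun ⟨σ, h⟩ i => (h i).trans (hg (σ i)), fun h => ⟨1, fun i => (h i).trans (hg i).symm⟩⟩

theorem prod_copies_le_copies_node (hd : 2 ≤ d) {D' : DTree d} (hD' : D' ≠ empty)
    {g : Fin d → DTree d} (hg : ∀ i, (g i).Iso D') (f : Fin d → DTree d) :
    ∏ i, copies D' (f i) ≤ copies (node g) (node f) := by
  simp only [copies_eq]
  rw [← ncard_setOf_preimage_mem (A := fun i => (f i).Leaf)]
  refine Set.ncard_le_ncard (fun (S : Set (node f).Leaf) hS => ?_)
    (Set.toFinite (α := Set (node f).Leaf) _)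
  change ((node f).induced S).Iso (node g)
  rw [induced_node, join, if_pos, node_iso_node_iff hg]
  · exact hS
  · exact ⟨⟨0, by omega⟩, ⟨1, by omega⟩, by simp, (hS _).ne_empty hD', (hS _).ne_empty hD'⟩

/-- If the root survives in the induced tree, every branch must contribute a copy of D'. If it is
suppressed, all chosen leaves lie in a single branch. -/
theorem copies_node_le {D' : DTree d}
    {g : Fin d → DTree d} (hg : ∀ i, (g i).Iso D') (f : Fin d → DTree d) :
    copies (node g) (node f) ≤ ∑ i, copies (node g) (f i) + ∏ i, copies D' (f i) := by
  simp only [copies_eq]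
  rw [← ncard_setOf_preimage_mem (A := fun i => (f i).Leaf)]
  have hsub : {S : Set (node f).Leaf | ((node f).induced S).Iso (node g)} ⊆
      (⋃ i, (fun S : Set (f i).Leaf => (Sigma.mk (β := fun i => (f i).Leaf) i '' S)) ''
        {S | ((f i).induced S).Iso (node g)}) ∪
      {S : Set (Σ i, (f i).Leaf) |
        ∀ i, Sigma.mk i ⁻¹' S ∈ {S : Set (f i).Leaf | ((f i).induced S).Iso D'}} := by
    intro S hS
    change ((node f).induced S).Iso (node g) at hS
    rw [induced_node, join] at hS
    split_ifs at hS with h h'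
    · exact Or.inr ((node_iso_node_iff hg).1 hS)
    · refine Or.inl (Set.mem_iUnion.2 ⟨h'.choose, _, hS, ?_⟩)
      ext ⟨j, x⟩
      constructor
      · rintro ⟨y, hy, hyx⟩
        rw [← hyx]
        exact hy
      · intro hx
        have hj : j = h'.choose := by
          by_contra hne
          exact h ⟨j, h'.choose, hne, induced_ne_empty (f j) ⟨x, hx⟩, h'.choose_spec⟩
        subst hj
        exact ⟨x, hx, rfl⟩
    · exact absurd rfl (hS.ne_empty (by simp))
  refine (Set.ncard_le_ncard hsub (Set.toFinite (α := Set (Σ i, (f i).Leaf)) _)).trans ?_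
  refine (Set.ncard_union_le _ _).trans (Nat.add_le_add_right ?_ _)
  refine (Set.ncard_iUnion_le_of_fintype _).trans (Finset.sum_le_sum fun i _ => ?_)
  exact Set.ncard_image_le (Set.toFinite (α := Set (f i).Leaf) _)

theorem size_pos : {T : DTree d} → T.IsDary → 0 < T.size
  | empty, h => absurd rfl h.1
  | leaf, _ => by rw [size_leaf]; exact one_pos
  | node f, ⟨_, ⟨i, _, _, hi, _⟩, h⟩ => by
      rw [size_node]
      exact (size_pos ⟨hi, h i⟩).trans_le (Finset.single_le_sum (f := fun i => (f i).size)
        (fun _ _ => Nat.zero_le _) (Finset.mem_univ i))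

theorem eq_leaf_of_size_eq_one {T : DTree d} (hT : T.IsDary) (h : T.size = 1) : T = leaf := by
  cases T with
  | empty => exact absurd rfl hT.1
  | leaf => rfl
  | node f =>
    obtain ⟨_, ⟨i, j, hij, hi, hj⟩, hf⟩ := hT
    have h2 : ∑ l ∈ {i, j}, (f l).size ≤ ∑ l, (f l).size :=
      Finset.sum_le_sum_of_subset (Finset.subset_univ _)
    rw [Finset.sum_pair hij, ← size_node, h] at h2
    have := size_pos ⟨hi, hf i⟩
    have := size_pos ⟨hj, hf j⟩
    omega

end DTree

/-! ### The inequality for branch sizes -/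

theorem mul_le_sum_of_prod_eq_pow {d : ℕ} (hd : d ≠ 0) {z : Fin d → ℝ} (hz : ∀ i, 0 ≤ z i)
    {q : ℝ} (hq : 0 ≤ q) (h : ∏ i, z i = q ^ d) : d * q ≤ ∑ i, z i := by
  have hd' : (0 : ℝ) < d := by positivity
  have := Real.geom_mean_le_arith_mean_weighted Finset.univ (fun _ : Fin d => (d : ℝ)⁻¹) z
    (fun _ _ => by positivity) (by simp [hd]) (fun i _ => hz i)
  rw [Real.finsetProd_rpow _ _ fun i _ => hz i, h, Real.pow_rpow_inv_natCast hq hd,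
    ← Finset.mul_sum] at this
  exact (le_inv_mul_iff₀ hd').1 this

/-- Expand the right side over words of length dk in d letters. Constant words give the pure powers;
the other d^(dk) - d words are averaged over cyclic shifts of the alphabet, and AM-GM bounds each
average below by ∏ x_i^k. -/
theorem sum_pow_add_prod_pow_le_sum_pow {d k : ℕ} (hd : d ≠ 0) (hk : k ≠ 0) {x : Fin d → ℝ}
    (hx : ∀ i, 0 ≤ x i) :
    ∑ i, x i ^ (d * k) + ((d : ℝ) ^ (d * k) - d) * ∏ i, x i ^ k ≤ (∑ i, x i) ^ (d * k) := by
  classical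
  have : NeZero d := ⟨hd⟩
  have hdk : 0 < d * k := by positivity
  have hd' : (0 : ℝ) < d := by positivity
  let y : (Fin (d * k) → Fin d) → ℝ := fun f => ∏ j, x (f j)
  let c : Fin d → Fin (d * k) → Fin d := fun i _ => i
  let s : Finset (Fin (d * k) → Fin d) := Finset.univ.image c
  have hc : Function.Injective c := fun i j h => congrFun h ⟨0, hdk⟩
  have hshift : ∀ i f, f + c i ∈ s ↔ f ∈ s := by
    intro i f
    simp only [s, Finset.mem_image, Finset.mem_univ, true_and]
    constructor
    · rintro ⟨a, ha⟩
      exact ⟨a - i, by rw [← sub_eq_iff_eq_add.2 ha]; rfl⟩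
    · rintro ⟨a, rfl⟩
      exact ⟨a + i, rfl⟩
  have hcard : (sᶜ.card : ℝ) = (d : ℝ) ^ (d * k) - d := by
    rw [Finset.card_compl, Finset.card_image_of_injective _ hc, Nat.cast_sub]
    · simp
    · simpa using Nat.le_self_pow hdk.ne' d
  have hsum : ∑ f ∈ s, y f = ∑ i, x i ^ (d * k) := by
    rw [Finset.sum_image fun _ _ _ _ h => hc h]
    simp [y, c]
  have hcycle : ∀ i, ∑ f ∈ sᶜ, y (f + c i) = ∑ f ∈ sᶜ, y f := by
    intro i
    refine Finset.sum_equiv (Equiv.addRight (c i)) (fun f => ?_) fun _ _ => rfl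
    rw [Finset.mem_compl, Finset.mem_compl]
    exact not_congr (hshift i f).symm
  have hq : 0 ≤ ∏ i, x i ^ k := Finset.prod_nonneg fun i _ => pow_nonneg (hx i) _
  -- Across the d shifts each position runs through every letter once, so the product of the shifted
  -- monomials does not depend on the word.
  have hamgm : ∀ f, d * ∏ i, x i ^ k ≤ ∑ i, y (f + c i) := by
    intro f
    refine mul_le_sum_of_prod_eq_pow hd (fun i => Finset.prod_nonneg fun j _ => hx _) hq ?_
    calc ∏ i, ∏ j, x (f j + i) = ∏ j, ∏ i, x (f j + i) := Finset.prod_comm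
      _ = ∏ _j : Fin (d * k), ∏ i, x i :=
        Finset.prod_congr rfl fun j _ => Equiv.prod_comp (Equiv.addLeft (f j)) x
      _ = (∏ i, x i ^ k) ^ d := by
        rw [Finset.prod_const, Finset.card_univ, Fintype.card_fin, Finset.prod_pow, ← pow_mul,
          mul_comm]
  have hmain : (d : ℝ) * ((sᶜ.card : ℝ) * ∏ i, x i ^ k) ≤ d * ∑ f ∈ sᶜ, y f := by
    calc (d : ℝ) * ((sᶜ.card : ℝ) * ∏ i, x i ^ k)
        = ∑ f ∈ sᶜ, d * ∏ i, x i ^ k := by rw [Finset.sum_const, nsmul_eq_mul]; ring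
      _ ≤ ∑ f ∈ sᶜ, ∑ i, y (f + c i) := Finset.sum_le_sum fun f _ => hamgm f
      _ = d * ∑ f ∈ sᶜ, y f := by
        rw [Finset.sum_comm, Finset.sum_congr rfl fun i _ => hcycle i]
        simp
  rw [Fintype.sum_pow, ← Finset.sum_add_sum_compl s, hsum, ← hcard]
  exact add_le_add_right (le_of_mul_le_mul_left hmain hd') _

/-! ### Upper bound for the number of copies -/

namespace DTree

variable {d : ℕ}

theorem copies_le_pow (D T : DTree d) : copies D T ≤ T.size ^ D.size :=
  (copies_le_choose D T).trans (Nat.choose_le_pow _ _)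

/-- The second summand covers the case of a branch with fewer than N leaves: its factor is at most
N^k, and the other d - 1 factors are bounded trivially. -/
theorem prod_copies_le {D' : DTree d} {b : ℝ} (hb : 0 ≤ b) {N : ℕ}
    (h : ∀ T : DTree d, T.IsDary → N ≤ T.size → (copies D' T : ℝ) ≤ b * T.size ^ D'.size)
    {f : Fin d → DTree d} (hf : ∀ i, (f i).IsDary) :
    ((∏ i, copies D' (f i) : ℕ) : ℝ) ≤ b ^ d * ∏ i, ((f i).size : ℝ) ^ D'.size +
      (N : ℝ) ^ D'.size * ((node f).size : ℝ) ^ ((d - 1) * D'.size) := by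
  by_cases hN : ∀ i, N ≤ (f i).size
  · refine le_add_of_le_of_nonneg ?_ (by positivity)
    calc ((∏ i, copies D' (f i) : ℕ) : ℝ) = ∏ i, (copies D' (f i) : ℝ) := Nat.cast_prod _ _
      _ ≤ ∏ i, b * ((f i).size : ℝ) ^ D'.size :=
        Finset.prod_le_prod (fun _ _ => Nat.cast_nonneg _) fun i _ => h _ (hf i) (hN i)
      _ = _ := by rw [Finset.prod_mul_distrib]; simp
  · push Not at hN
    obtain ⟨j, hj⟩ := hN
    refine le_add_of_nonneg_of_le (by positivity) ?_
    have hsize : ∀ i, (f i).size ≤ (node f).size := fun i => by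
      rw [size_node]
      exact Finset.single_le_sum (f := fun i => (f i).size) (fun _ _ => Nat.zero_le _)
        (Finset.mem_univ i)
    have : ∏ i, copies D' (f i) ≤ N ^ D'.size * (node f).size ^ ((d - 1) * D'.size) := by
      rw [← Finset.mul_prod_erase _ _ (Finset.mem_univ j)]
      refine Nat.mul_le_mul ((copies_le_pow _ _).trans (Nat.pow_le_pow_left hj.le _)) ?_
      refine (Finset.prod_le_pow_card _ _ ((node f).size ^ D'.size) fun i _ =>
        (copies_le_pow _ _).trans (Nat.pow_le_pow_left (hsize i) _)).trans ?_
      rw [Finset.card_erase_of_mem (Finset.mem_univ j), Finset.card_univ, Fintype.card_fin,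
        ← pow_mul, mul_comm]
    exact_mod_cast this

/-- Each vertex with d nonempty branches costs one error term from `prod_copies_le`; the factor ‖T‖
- 1 leaves room for all of them. -/
theorem copies_node_le_of_forall_copies_le (hd : 2 ≤ d) {D' : DTree d} (hD' : D'.IsDary)
    {g : Fin d → DTree d} (hg : ∀ i, (g i).Iso D') {b : ℝ} (hb : 0 ≤ b) {N : ℕ}
    (h : ∀ T : DTree d, T.IsDary → N ≤ T.size → (copies D' T : ℝ) ≤ b * T.size ^ D'.size) :
    (T : DTree d) → T.IsProper → (copies (node g) T : ℝ) ≤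
      b ^ d / ((d : ℝ) ^ (d * D'.size) - d) * T.size ^ (d * D'.size) +
        (N : ℝ) ^ D'.size * T.size ^ ((d - 1) * D'.size) * (T.size - 1 : ℕ) := by
  have hk := size_pos hD'
  have hK : d < d ^ (d * D'.size) := by
    conv_lhs => rw [← pow_one d]
    exact Nat.pow_lt_pow_right hd (by nlinarith)
  have hpos : (0 : ℝ) < (d : ℝ) ^ (d * D'.size) - d := by
    rw [sub_pos]
    exact_mod_cast hK
  have hgsize : (node g).size = d * D'.size := by
    rw [size_node, Finset.sum_congr rfl fun i _ => (hg i).size_eq]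
    simp
  have hsmall : ∀ T : DTree d, T.size ≤ 1 → copies (node g) T = 0 := fun T hT =>
    Nat.le_zero.1 ((copies_le_choose _ _).trans_eq
      (Nat.choose_eq_zero_of_lt (by rw [hgsize]; nlinarith)))
  intro T
  induction T with
  | empty =>
    intro _
    rw [hsmall _ (by simp [size_empty]), Nat.cast_zero]
    positivity
  | leaf =>
    intro _
    rw [hsmall _ (by simp [size_leaf]), Nat.cast_zero]
    positivity
  | node f ih =>
    intro hT
    set A := b ^ d / ((d : ℝ) ^ (d * D'.size) - d) with hA
    set E : ℝ := (N : ℝ) ^ D'.size * ((node f).size : ℝ) ^ ((d - 1) * D'.size) with hE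
    have hE0 : 0 ≤ E := by positivity
    have hA0 : 0 ≤ A := by positivity
    have hle : ∀ i, (f i).size ≤ (node f).size := fun i => by
      rw [size_node]
      exact Finset.single_le_sum (f := fun i => (f i).size) (fun _ _ => Nat.zero_le _)
        (Finset.mem_univ i)
    have hbranch : ∀ i, (copies (node g) (f i) : ℝ) ≤
        A * ((f i).size : ℝ) ^ (d * D'.size) + E * ((f i).size - 1 : ℕ) := fun i => by
      refine (ih i (hT.2 i)).trans ?_
      have : ((f i).size : ℝ) ≤ (node f).size := by exact_mod_cast hle i
      rw [hE]
      gcongr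
    have hsum : ((∑ i, copies (node g) (f i) : ℕ) : ℝ) ≤
        A * ∑ i, ((f i).size : ℝ) ^ (d * D'.size) + E * (∑ i, ((f i).size - 1) : ℕ) := by
      push_cast
      rw [Finset.mul_sum, Finset.mul_sum, ← Finset.sum_add_distrib]
      refine Finset.sum_le_sum fun i _ => ?_
      exact_mod_cast hbranch i
    -- The value of A is chosen so that A (d^(dk) - d) = b^d.
    have hmuirhead : A * ∑ i, ((f i).size : ℝ) ^ (d * D'.size) +
        b ^ d * ∏ i, ((f i).size : ℝ) ^ D'.size ≤ A * ((node f).size : ℝ) ^ (d * D'.size) := by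
      have := mul_le_mul_of_nonneg_left (sum_pow_add_prod_pow_le_sum_pow (d := d) (by omega) hk.ne'
        (x := fun i => ((f i).size : ℝ)) fun _ => Nat.cast_nonneg _) hA0
      rw [mul_add, ← mul_assoc, div_mul_cancel₀ _ hpos.ne'] at this
      rw [size_node, Nat.cast_sum]
      exact this
    have hrec : (copies (node g) (node f) : ℝ) ≤
        (∑ i, copies (node g) (f i) : ℕ) + (∏ i, copies D' (f i) : ℕ) := by
      exact_mod_cast copies_node_le hg f
    by_cases hf : ∀ i, f i ≠ empty
    · have hprod := prod_copies_le hb h fun i => ⟨hf i, hT.2 i⟩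
      -- The sum is ‖T‖ - d ≤ ‖T‖ - 2, which leaves one unit for the error at this root.
      have hcount : ∑ i, ((f i).size - 1) + 1 ≤ (node f).size - 1 := by
        have : ∑ i, ((f i).size - 1) + d = (node f).size := by
          have h1 : ∑ i, (((f i).size - 1) + 1) = ∑ i, (f i).size :=
            Finset.sum_congr rfl fun i _ => Nat.sub_add_cancel (size_pos ⟨hf i, hT.2 i⟩)
          rw [size_node, ← h1, Finset.sum_add_distrib]
          simp
        omega
      have hcount' : E * (∑ i, ((f i).size - 1) : ℕ) + E ≤ E * ((node f).size - 1 : ℕ) := by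
        rw [← mul_add_one]
        gcongr
        exact_mod_cast hcount
      linarith
    · push Not at hf
      obtain ⟨j, hj⟩ := hf
      -- An empty branch kills the product, so no new error arises here.
      have hzero : ∏ i, copies D' (f i) = 0 :=
        Finset.prod_eq_zero (Finset.mem_univ j) (Nat.le_zero.1 ((copies_le_choose _ _).trans_eq
          (Nat.choose_eq_zero_of_lt (by rwa [hj, size_empty]))))
      have hcount : ∑ i, ((f i).size - 1) ≤ (node f).size - 1 := by
        obtain ⟨⟨i, _, _, hi, _⟩, hT'⟩ := hT
        have hi' : 1 ≤ (f i).size := size_pos ⟨hi, hT' i⟩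
        have : ∑ i, ((f i).size - 1) < ∑ i, (f i).size :=
          Finset.sum_lt_sum (fun _ _ => Nat.sub_le _ _) ⟨i, Finset.mem_univ i, by omega⟩
        rw [size_node]
        omega
      have hcount' : E * (∑ i, ((f i).size - 1) : ℕ) ≤ E * ((node f).size - 1 : ℕ) := by
        gcongr
      have hprod : 0 ≤ b ^ d * ∏ i, ((f i).size : ℝ) ^ D'.size := by positivity
      rw [hzero, Nat.cast_zero] at hrec
      linarith

end DTree

/-! ### Asymptotics of binomial coefficients -/

open Topology in
theorem tendsto_pow_div_choose (k : ℕ) :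
    Tendsto (fun n : ℕ => (n : ℝ) ^ k / n.choose k) atTop (𝓝 k !) := by
  have h := (isEquivalent_choose k).symm
  have hne : ∀ᶠ n : ℕ in atTop, (n.choose k : ℝ) ≠ 0 := by
    filter_upwards [eventually_ge_atTop k] with n hn
    exact_mod_cast (Nat.choose_pos hn).ne'
  have := ((Asymptotics.isEquivalent_iff_tendsto_one hne).1 h).const_mul (k ! : ℝ)
  rw [mul_one] at this
  refine this.congr fun n => ?_
  have : (k ! : ℝ) ≠ 0 := by exact_mod_cast k.factorial_ne_zero
  simp only [Pi.div_apply]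
  field_simp

open Topology in
theorem tendsto_choose_pow_div_choose_mul {d : ℕ} (hd : d ≠ 0) (k : ℕ) :
    Tendsto (fun m : ℕ => (m.choose k : ℝ) ^ d / (d * m).choose (d * k)) atTop
      (𝓝 ((d * k)! / (d : ℝ) ^ (d * k) / (k ! : ℝ) ^ d)) := by
  have hk : (k ! : ℝ) ≠ 0 := by exact_mod_cast k.factorial_ne_zero
  have hd' : (d : ℝ) ≠ 0 := by exact_mod_cast hd
  have h1 := (tendsto_pow_div_choose (d * k)).comp (tendsto_id.const_mul_atTop' hd.bot_lt)
  have h2 := ((tendsto_pow_div_choose k).inv₀ hk).pow d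
  have h3 := (h1.mul h2).div_const ((d : ℝ) ^ (d * k))
  have heq : ((d * k)! / (d : ℝ) ^ (d * k) / (k ! : ℝ) ^ d) =
      ((d * k)! : ℝ) * (k ! : ℝ)⁻¹ ^ d / (d : ℝ) ^ (d * k) := by
    rw [inv_pow]
    field_simp
  rw [heq]
  refine h3.congr' ?_
  filter_upwards [eventually_gt_atTop 0] with m hm
  have hm' : (m : ℝ) ≠ 0 := by exact_mod_cast hm.ne'
  simp only [Function.comp_apply, id, Nat.cast_mul, inv_div, div_pow, mul_pow, ← pow_mul]
  rw [mul_comm k d]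
  field_simp

/-! ### Densities and inducibility -/

namespace DTree

variable {d : ℕ}

theorem density_nonneg (D T : DTree d) : 0 ≤ density D T := by
  unfold density
  positivity

theorem density_le_one (D T : DTree d) : density D T ≤ 1 :=
  div_le_one_of_le₀ (by exact_mod_cast copies_le_choose D T) (Nat.cast_nonneg _)

theorem copies_eq_density_mul_choose (D T : DTree d) :
    (copies D T : ℝ) = density D T * T.size.choose D.size := by
  rw [density]
  by_cases h : T.size.choose D.size = 0
  · have := copies_le_choose D T
    rw [h] at this
    simp [h, Nat.le_zero.1 this]
  · rw [div_mul_cancel₀]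
    exact_mod_cast h

theorem maxDensity_nonneg (D : DTree d) (n : ℕ) : 0 ≤ maxDensity D n :=
  Real.sSup_nonneg (by rintro _ ⟨T, _, _, rfl⟩; exact density_nonneg D T)

theorem maxDensity_le {D : DTree d} {n : ℕ} {c : ℝ} (hc : 0 ≤ c)
    (h : ∀ T : DTree d, T.IsDary → T.size = n → density D T ≤ c) : maxDensity D n ≤ c :=
  Real.sSup_le (by rintro _ ⟨T, hT, hn, rfl⟩; exact h T hT hn) hc

theorem maxDensity_le_one (D : DTree d) (n : ℕ) : maxDensity D n ≤ 1 :=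
  maxDensity_le zero_le_one fun T _ _ => density_le_one D T

theorem density_le_maxDensity (D : DTree d) {T : DTree d} (hT : T.IsDary) :
    density D T ≤ maxDensity D T.size :=
  le_csSup ⟨1, by rintro _ ⟨T, _, _, rfl⟩; exact density_le_one D T⟩ ⟨T, hT, rfl, rfl⟩

theorem exists_lt_density_of_lt_maxDensity {D : DTree d} {n : ℕ} {b : ℝ} (hb : 0 ≤ b)
    (h : b < maxDensity D n) : ∃ T : DTree d, T.IsDary ∧ T.size = n ∧ b < density D T := by
  by_contra! hT
  exact h.not_ge (maxDensity_le hb hT)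

theorem isBoundedUnder_maxDensity (D : DTree d) (l : Filter ℕ) :
    IsBoundedUnder (· ≤ ·) l (maxDensity D) :=
  isBoundedUnder_of ⟨1, maxDensity_le_one D⟩

theorem isCoboundedUnder_maxDensity (D : DTree d) :
    IsCoboundedUnder (· ≤ ·) atTop (maxDensity D) :=
  (isBoundedUnder_of ⟨0, maxDensity_nonneg D⟩ :
    IsBoundedUnder (· ≥ ·) atTop (maxDensity D)).isCoboundedUnder_le

theorem le_inducibility {D : DTree d} {c : ℝ} (h : ∃ᶠ n in atTop, c ≤ maxDensity D n) :
    c ≤ inducibility D :=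
  le_limsup_of_frequently_le h (isBoundedUnder_maxDensity D _)

theorem inducibility_nonneg (D : DTree d) : 0 ≤ inducibility D :=
  le_inducibility (Frequently.of_forall (maxDensity_nonneg D))

theorem isDary_node_const (hd : 2 ≤ d) {T : DTree d} (hT : T.IsDary) :
    (node fun _ : Fin d => T).IsDary :=
  ⟨by simp, ⟨⟨0, by omega⟩, ⟨1, by omega⟩, by simp, hT.1, hT.1⟩, fun _ => hT.2⟩

theorem size_node_const (T : DTree d) : (node fun _ : Fin d => T).size = d * T.size := by
  simp [size_node]

theorem exists_isDary_le_size (hd : 2 ≤ d) (n : ℕ) : ∃ T : DTree d, T.IsDary ∧ n ≤ T.size := by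
  induction n with
  | zero => exact ⟨leaf, ⟨by simp, trivial⟩, Nat.zero_le _⟩
  | succ n ih =>
    obtain ⟨T, hT, hn⟩ := ih
    refine ⟨_, isDary_node_const hd hT, ?_⟩
    rw [size_node_const]
    have := size_pos hT
    nlinarith

theorem isProper_join {g : Fin d → DTree d} (hg : ∀ i, (g i).IsProper) : (join g).IsProper := by
  classical
  unfold join
  split_ifs with h h'
  · exact ⟨h, hg⟩
  · exact hg _
  · trivial

theorem isProper_induced : (T : DTree d) → (S : Set T.Leaf) → (T.induced S).IsProper
  | empty, _ => trivial
  | leaf, S => by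
      rw [induced]
      split_ifs <;> trivial
  | node f, S => by
      rw [induced_node]
      exact isProper_join fun i => isProper_induced (f i) _

theorem size_le_copies_leaf (T : DTree d) : T.size ≤ copies leaf T := by
  rw [copies_eq, size, ← Set.ncard_univ,
    ← Set.ncard_image_of_injective _ (Set.singleton_injective (α := T.Leaf))]
  refine Set.ncard_le_ncard ?_ (Set.toFinite _)
  rintro _ ⟨x, _, rfl⟩
  have : T.induced {x} = leaf := eq_leaf_of_size_eq_one
    ⟨induced_ne_empty T (Set.singleton_nonempty x), isProper_induced T _⟩
    (by rw [size_induced, Set.ncard_singleton])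
  simp only [Set.mem_ofPred_eq, this]
  exact Iso.refl _

/-- Needed for k = 1: the bound on c(D', T) then holds for every T, so the threshold N can be 0. -/
theorem one_le_inducibility_leaf (hd : 2 ≤ d) : 1 ≤ inducibility (leaf : DTree d) := by
  refine le_inducibility (frequently_atTop.2 fun n => ?_)
  obtain ⟨T, hT, hn⟩ := exists_isDary_le_size hd n
  refine ⟨T.size, hn, le_trans ?_ (density_le_maxDensity leaf hT)⟩
  have hpos : (0 : ℝ) < T.size := by exact_mod_cast size_pos hT
  rw [density, size_leaf, Nat.choose_one_right, one_le_div hpos]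
  exact_mod_cast size_le_copies_leaf T

theorem copies_le_of_maxDensity_le {D : DTree d} {a : ℝ} (ha : 0 ≤ a) {T : DTree d}
    (hT : T.IsDary) (h : maxDensity D T.size ≤ a) :
    (copies D T : ℝ) ≤ a / D.size ! * T.size ^ D.size := by
  rw [copies_eq_density_mul_choose, div_mul_eq_mul_div, mul_div_assoc]
  exact mul_le_mul ((density_le_maxDensity D hT).trans h) (Nat.choose_le_pow_div _ _)
    (Nat.cast_nonneg _) ha

theorem exists_forall_copies_le (hd : 2 ≤ d) {D : DTree d} (hD : D.IsDary) {ε : ℝ} (hε : 0 < ε) :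
    ∃ N : ℕ, (D.size = 1 → N = 0) ∧ ∀ T : DTree d, T.IsDary → N ≤ T.size →
      (copies D T : ℝ) ≤ (inducibility D + ε) / D.size ! * T.size ^ D.size := by
  have ha : 0 ≤ inducibility D + ε := by linarith [inducibility_nonneg D]
  by_cases h1 : D.size = 1
  · refine ⟨0, fun _ => rfl, fun T hT _ => copies_le_of_maxDensity_le ha hT ?_⟩
    have : 1 ≤ inducibility D := by
      rw [eq_leaf_of_size_eq_one hD h1]
      exact one_le_inducibility_leaf hd
    linarith [maxDensity_le_one D T.size]
  · obtain ⟨N, hN⟩ := eventually_atTop.1 (eventually_lt_of_limsup_lt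
      (lt_add_of_pos_right (inducibility D) hε) (isBoundedUnder_maxDensity D _))
    exact ⟨N, fun h => absurd h h1, fun T hT hNT =>
      copies_le_of_maxDensity_le ha hT (hN _ hNT).le⟩

/-! ### Passage to the limit and the two bounds -/

open Topology in
theorem tendsto_copies_bound (hd : d ≠ 0) {k N : ℕ} (hk : k ≠ 0) (hN : k = 1 → N = 0) (A : ℝ) :
    Tendsto (fun n : ℕ => (A * (n : ℝ) ^ (d * k) +
      (N : ℝ) ^ k * (n : ℝ) ^ ((d - 1) * k) * (n - 1 : ℕ)) / n.choose (d * k)) atTop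
      (𝓝 (A * (d * k)!)) := by
  have hsmall : Tendsto (fun n : ℕ => (N : ℝ) ^ k * ((n - 1 : ℕ) * ((n : ℝ) ^ k)⁻¹)) atTop
      (𝓝 0) := by
    by_cases h1 : k = 1
    -- For k = 1 the error has the same degree as the main term; only N = 0 removes it.
    · simp [hN h1, hk]
    · have hlim : Tendsto (fun n : ℕ => (N : ℝ) ^ k * (n : ℝ)⁻¹) atTop (𝓝 0) := by
        simpa using (tendsto_inv_atTop_nhds_zero_nat (𝕜 := ℝ)).const_mul ((N : ℝ) ^ k)
      refine squeeze_zero (fun n => by positivity) (fun n => ?_) hlim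
      gcongr
      rcases Nat.eq_zero_or_pos n with rfl | hn
      · simp
      have hn' : (1 : ℝ) ≤ n := by exact_mod_cast hn
      have hpred : ((n - 1 : ℕ) : ℝ) ≤ n := by exact_mod_cast Nat.sub_le n 1
      rw [← div_eq_mul_inv, div_le_iff₀ (by positivity)]
      calc ((n - 1 : ℕ) : ℝ) ≤ n := hpred
        _ = (n : ℝ)⁻¹ * (n : ℝ) ^ 2 := by field_simp
        _ ≤ (n : ℝ)⁻¹ * (n : ℝ) ^ k := by
          gcongr
          omega
  have := (tendsto_const_nhds (x := A)).add hsmall |>.mul (tendsto_pow_div_choose (d * k))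
  rw [add_zero] at this
  refine this.congr' ?_
  filter_upwards [eventually_gt_atTop 0] with n hn
  have hn' : (n : ℝ) ≠ 0 := by exact_mod_cast hn.ne'
  have hpow : (n : ℝ) ^ (d * k) = n ^ ((d - 1) * k) * n ^ k := by
    rw [← pow_add, ← Nat.succ_mul, Nat.succ_eq_add_one, Nat.sub_add_cancel (by omega)]
  rw [hpow]
  field_simp

theorem size_node_of_iso {D' : DTree d} {g : Fin d → DTree d} (hg : ∀ i, (g i).Iso D') :
    (node g).size = d * D'.size := by
  rw [size_node, Finset.sum_congr rfl fun i _ => (hg i).size_eq]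
  simp

open Topology in
theorem inducibility_node_le (hd : 2 ≤ d) {D' : DTree d} (hD' : D'.IsDary)
    {g : Fin d → DTree d} (hg : ∀ i, (g i).Iso D') :
    inducibility (node g) ≤ ((inducibility D') / D'.size !) ^ d /
      ((d : ℝ) ^ (d * D'.size) - d) * (d * D'.size)! := by
  have hlim : Tendsto (fun ε : ℝ => ((inducibility D' + ε) / D'.size !) ^ d /
      ((d : ℝ) ^ (d * D'.size) - d) * (d * D'.size)!) (𝓝[>] 0)
      (𝓝 (((inducibility D' + 0) / D'.size !) ^ d /
        ((d : ℝ) ^ (d * D'.size) - d) * (d * D'.size)!)) :=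
    tendsto_nhdsWithin_of_tendsto_nhds (Continuous.tendsto (by fun_prop) 0)
  rw [add_zero] at hlim
  refine ge_of_tendsto hlim ?_
  filter_upwards [self_mem_nhdsWithin] with ε hε
  obtain ⟨N, hN, h⟩ := exists_forall_copies_le hd hD' hε
  have hb : 0 ≤ (inducibility D' + ε) / D'.size ! :=
    div_nonneg (by linarith [inducibility_nonneg D', Set.mem_Ioi.1 hε]) (Nat.cast_nonneg _)
  have hF := tendsto_copies_bound (d := d) (by omega) (size_pos hD').ne' hN
    (((inducibility D' + ε) / D'.size !) ^ d / ((d : ℝ) ^ (d * D'.size) - d))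
  rw [← hF.limsup_eq]
  have hpos : (0 : ℝ) ≤ (d : ℝ) ^ (d * D'.size) - d := by
    rw [sub_nonneg]
    have := size_pos hD'
    exact_mod_cast Nat.le_self_pow (by positivity) d
  refine limsup_le_limsup (Eventually.of_forall fun n => maxDensity_le (by positivity) ?_)
    (isCoboundedUnder_maxDensity _) hF.isBoundedUnder_le
  rintro T hT rfl
  rw [density, size_node_of_iso hg]
  exact div_le_div_of_nonneg_right
    (copies_node_le_of_forall_copies_le hd hD' hg hb h T hT.2) (Nat.cast_nonneg _)

open Topology in
theorem le_inducibility_node (hd : 2 ≤ d) {D' : DTree d} (hD' : D'.IsDary)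
    {g : Fin d → DTree d} (hg : ∀ i, (g i).Iso D') :
    inducibility D' ^ d * ((d * D'.size)! / (d : ℝ) ^ (d * D'.size) / (D'.size ! : ℝ) ^ d) ≤
      inducibility (node g) := by
  have hd0 : d ≠ 0 := by omega
  rcases (inducibility_nonneg D').eq_or_lt with h0 | h0
  -- A positive inducibility is needed below to approach it from the left by positive b.
  · rw [← h0, zero_pow hd0, zero_mul]
    exact inducibility_nonneg _
  set r : ℝ := (d * D'.size)! / (d : ℝ) ^ (d * D'.size) / (D'.size ! : ℝ) ^ d with hr
  have hlim : Tendsto (fun b : ℝ => b ^ d * r) (𝓝[<] inducibility D')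
      (𝓝 (inducibility D' ^ d * r)) :=
    tendsto_nhdsWithin_of_tendsto_nhds (Continuous.tendsto (by fun_prop) _)
  refine le_of_tendsto hlim ?_
  filter_upwards [Ioo_mem_nhdsLT h0] with b ⟨hb0, hb⟩
  refine le_of_forall_lt_imp_le_of_dense fun c hc => le_inducibility ?_
  have hR := (tendsto_choose_pow_div_choose_mul hd0 D'.size).const_mul (b ^ d)
  have hfreq : ∃ᶠ m in atTop, b < maxDensity D' m :=
    frequently_lt_of_lt_limsup (isCoboundedUnder_maxDensity D') hb
  have hmul : Tendsto (fun m : ℕ => d * m) atTop atTop := tendsto_id.const_mul_atTop' hd0.bot_lt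
  -- Only sizes dm are reached, for infinitely many m, which suffices for a limsup.
  refine hmul.frequently ((hfreq.and_eventually (hR.eventually_const_lt hc)).mono ?_)
  rintro m ⟨hm, hcm⟩
  obtain ⟨T, hT, rfl, hbT⟩ := exists_lt_density_of_lt_maxDensity hb0.le hm
  refine hcm.le.trans (le_trans ?_ (size_node_const T ▸
    density_le_maxDensity (node g) (isDary_node_const hd hT)))
  rw [density, size_node_const, size_node_of_iso hg, ← mul_div_assoc, ← mul_pow]
  gcongr
  calc (b * (T.size.choose D'.size : ℝ)) ^ d ≤ (copies D' T : ℝ) ^ d := by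
        rw [copies_eq_density_mul_choose]
        gcongr
    _ ≤ copies (node g) (node fun _ => T) := by
        have := prod_copies_le_copies_node hd hD'.1 hg fun _ => T
        rw [Finset.prod_const, Finset.card_univ, Fintype.card_fin] at this
        exact_mod_cast this

end DTree

theorem theorem8 (d : ℕ) (hd : 2 ≤ d) (D D' : DTree d) (hD : D.IsDary) (hD' : D'.IsDary)
    (hbranches : ∀ i : Fin d, (D.branch i).Iso D') :
    (D.size ! : ℝ) / (d : ℝ) ^ D.size * (D'.inducibility / (D'.size ! : ℝ)) ^ d
        ≤ D.inducibility ∧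
      D.inducibility ≤
        (D.size ! : ℝ) / ((d : ℝ) ^ D.size - (d : ℝ)) *
          (D'.inducibility / (D'.size ! : ℝ)) ^ d := by
  cases D with
  | empty => exact absurd rfl hD.1
  -- By convention all branches of a leaf are empty, while D' is not.
  | leaf => exact absurd rfl ((hbranches ⟨0, by omega⟩).ne_empty hD'.1)
  | node g =>
    have hg : ∀ i, (g i).Iso D' := hbranches
    rw [DTree.size_node_of_iso hg]
    constructor
    · refine le_trans (le_of_eq ?_) (DTree.le_inducibility_node hd hD' hg)
      rw [div_pow]
      ring
    · refine (DTree.inducibility_node_le hd hD' hg).trans (le_of_eq ?_)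
      ring
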